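/- Let $a<b$ be real numbers. For functions $u$ on $[a,b]$ write $u'$ for the derivative (one-sided at the endpoints), and let $\mathcal F\subset C^1([a,b])$ be a finite-dimensional real vector space of functions. Put $\mathcal G=(\mathcal F\mathcal F)'=\operatorname{span}\{(fh)' : f,h\in\mathcal F\}$. **Definitions.** Functions $g_1,\dots,g_N$ form a *Tchebyshev system* on $[a,b]$ if they are real-valued and continuous on $[a,b]$ and $\det(g_j(x_i))_{i,j=1}^N\neq 0$ for all distinct $x_1,\dots,x_N\in[a,b]$. An *$\mathcal F$-based SBP operator of dimension $m$* consists of nodes $a\le x_1<\dots<x_m\le b$ and real $m\times m$ matrices $P,Q$ with $D=P^{-1}Q$ such that (i) $D\,(f(x_1),\dots,f(x_m))^\top=(f'(x_1),\dots,f'(x_m))^\top$ for all $f\in\mathcal F$, (ii) $P$ is symmetric positive definite, (iii) $Q+Q^\top=\operatorname{diag}(-1,0,\dots,0,1)$. It is *closed* if $a$ and $b$ are among its nodes, and *diagonal-norm* if $P$ is diagonal. A closed diagonal-norm $\mathcal F$-based SBP operator is *optimal* if there is no closed diagonal-norm $\mathcal F$-based SBP operator of smaller dimension. When $\dim\mathcal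 G=2n$, an *$(n+1)$-point generalised Gauss–Lobatto rule for $\mathcal G$* consists of nodes $a=x_1<\dots<x_{n+1}=b$ and real weights $w_1,\dots,w_{n+1}$ with $\int_a^b g(t)\,dt=\sum_{k=1}^{n+1}w_k\,g(x_k)$ for all $g\in\mathcal G$. For a Tchebyshev system $g_1,\dots,g_{2n}$, an *upper principal representation* of a vector $(c_1,\dots,c_{2n})$ consists of finitely many nodes $x_1<\dots<x_m$ in $[a,b]$ and weights $w_k>0$ with $\sum_k w_k\,g_j(x_k)=c_j$ for all $j$, such that $b$ is a node and the index of the nodes (each interior node counted $1$, each of $a,b$ counted $\tfrac12$) equals $n$. **Corollary 3.6.** Let $n\ge 1$ and suppose that $\mathcal G=(\mathcal F\mathcal F)'=\operatorname{span}\{g_1,\dots,g_{2n}\}$, where $g_1,\dots,g_{2n}$ is a Tchebyshev system on $[a,b]$. Then: 1. There exists a closed diagonal-norm $\mathcal F$-based SBP operator. 2. There is exactly one $(n+1)$-point generalised Gauss–Lobatto rule $(\boldsymbol x,\boldsymbol w)$ for $\mathcal G$. All its weights are positive, and it is the unique upper principal representation (with any number of nodes) of the moment vector $\big(\int_a^b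 g_j(t)\,dt\big)_{j=1}^{2n}$. 3. Optimal closed diagonal-norm $\mathcal F$-based SBP operators exist, and all of them have dimension $n+1$. An $\mathcal F$-based SBP operator of dimension $n+1$ is an optimal closed diagonal-norm operator if and only if its node vector is $\boldsymbol x$ and $P=\operatorname{diag}(\boldsymbol w)$. -/

import Mathlib

namespace FSBP

/-- The extension by zero to the real line of a function on `[a, b]`. Only its values on `[a, b]`
matter below: smoothness and derivatives are taken within `[a, b]`. -/
noncomputable def extendZero {a b : ℝ} (u : Set.Icc a b → ℝ) : ℝ → ℝ :=
  Function.extend Subtype.val u 0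

/-- `u ∈ C¹([a, b])` (one-sided derivatives at the endpoints). -/
def IsC1 {a b : ℝ} (u : Set.Icc a b → ℝ) : Prop :=
  ContDiffOn ℝ 1 (extendZero u) (Set.Icc a b)

/-- The derivative `u'` on `[a, b]` (one-sided at the endpoints). -/
noncomputable def ddx {a b : ℝ} (u : Set.Icc a b → ℝ) : Set.Icc a b → ℝ :=
  fun t => derivWithin (extendZero u) (Set.Icc a b) t

/-- The integral `∫_a^b u(t) dt`. -/
noncomputable def integral {a b : ℝ} (u : Set.Icc a b → ℝ) : ℝ :=
  ∫ t in a..b, extendZero u t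

/-- The function space `(𝓕𝓕)'`, spanned by the derivatives `(f h)'` with `f, h ∈ 𝓕`. -/
noncomputable def productDeriv {a b : ℝ} (F : Submodule ℝ (Set.Icc a b → ℝ)) :
    Submodule ℝ (Set.Icc a b → ℝ) :=
  Submodule.span ℝ {u | ∃ f ∈ F, ∃ h ∈ F, u = ddx (f * h)}

/-- `g₁, …, g_N` is a Tchebyshev system on `[a, b]`: the functions are continuous and
`det (g_j (x_i)) ≠ 0` for all distinct points `x₁, …, x_N ∈ [a, b]`. -/
def IsTchebyshevSystem {a b : ℝ} {N : ℕ} (g : Fin N → Set.Icc a b → ℝ) : Prop :=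
  (∀ j, Continuous (g j)) ∧
    ∀ x : Fin N → Set.Icc a b, Function.Injective x →
      (Matrix.of fun i j => g j (x i)).det ≠ 0

/-- A family of nodes is closed if both endpoints `a` and `b` are among the nodes. -/
def ClosedNodes {a b : ℝ} {m : ℕ} (x : Fin m → Set.Icc a b) : Prop :=
  (∃ i, (x i : ℝ) = a) ∧ (∃ j, (x j : ℝ) = b)

/-- The quadrature rule with nodes `x` and weights `w` is exact (with weight function `1`) on the
function space `G`. -/
def IsExact {a b : ℝ} {m : ℕ} (G : Submodule ℝ (Set.Icc a b → ℝ))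
    (x : Fin m → Set.Icc a b) (w : Fin m → ℝ) : Prop :=
  ∀ u ∈ G, integral u = ∑ k, w k * u (x k)

/-- A generalised Gauss–Lobatto quadrature rule with `n + 1` points for the function space `G`
(intended for `dim G = 2 n`): ordered distinct nodes that include `a` and `b`, and exactness on
`G`. No sign condition is imposed on the weights. -/
structure IsGaussLobatto {a b : ℝ} {n : ℕ} (G : Submodule ℝ (Set.Icc a b → ℝ))
    (x : Fin (n + 1) → Set.Icc a b) (w : Fin (n + 1) → ℝ) : Prop where
  strictMono : StrictMono x
  closed : ClosedNodes x
  exact_on : IsExact G x w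

/-- The index of a family of nodes: interior nodes count `1`, endpoints count `1/2`. -/
noncomputable def nodeIndex {a b : ℝ} {m : ℕ} (x : Fin m → Set.Icc a b) : ℝ :=
  ∑ k, if (x k : ℝ) = a ∨ (x k : ℝ) = b then (1 / 2 : ℝ) else 1

/-- `(x, w)` is an upper principal representation of the moment vector `c` with respect to
`g₁, …, g_N`: a representation `c_j = ∑ₖ wₖ g_j(xₖ)` with positive weights, of index `N / 2`,
that involves the right endpoint `b`. -/
structure IsUpperPrincipalRepresentation {a b : ℝ} {N m : ℕ} (g : Fin N → Set.Icc a b → ℝ)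
    (c : Fin N → ℝ) (x : Fin m → Set.Icc a b) (w : Fin m → ℝ) : Prop where
  strictMono : StrictMono x
  weights_pos : ∀ k, 0 < w k
  represents : ∀ j, ∑ k, w k * g j (x k) = c j
  index_eq : nodeIndex x = (N : ℝ) / 2
  right_mem : ∃ k, (x k : ℝ) = b

/-- The `m × m` matrix `B = diag(-1, 0, …, 0, 1)`. -/
def boundaryMatrix (m : ℕ) : Matrix (Fin m) (Fin m) ℝ :=
  Matrix.diagonal fun i =>
    (if (i : ℕ) + 1 = m then 1 else 0) - (if (i : ℕ) = 0 then 1 else 0)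

/-- An `𝓕`-based summation-by-parts operator `D = P⁻¹ Q` of dimension `m`, together with its
nodes. -/
structure Operator {a b : ℝ} (F : Submodule ℝ (Set.Icc a b → ℝ)) (m : ℕ) where
  nodes : Fin m → Set.Icc a b
  P : Matrix (Fin m) (Fin m) ℝ
  Q : Matrix (Fin m) (Fin m) ℝ
  strictMono : StrictMono nodes
  exact_on : ∀ f ∈ F, (P⁻¹ * Q).mulVec (fun i => f (nodes i)) = fun i => ddx f (nodes i)
  posDef : P.PosDef
  sbp : Q + Q.transpose = boundaryMatrix m

/-- Closed operators with a diagonal norm matrix `P`. -/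
def Operator.IsClosedDiagonal {a b : ℝ} {F : Submodule ℝ (Set.Icc a b → ℝ)} {m : ℕ}
    (T : Operator F m) : Prop :=
  ClosedNodes T.nodes ∧ T.P.IsDiag

/-- A closed diagonal-norm operator is optimal if there is no closed diagonal-norm operator (for
the same function space) of smaller dimension. -/
def Operator.IsOptimalClosedDiagonal {a b : ℝ} {F : Submodule ℝ (Set.Icc a b → ℝ)} {m : ℕ}
    (T : Operator F m) : Prop :=
  T.IsClosedDiagonal ∧ ∀ k < m, ¬ ∃ S : Operator F k, S.IsClosedDiagonal

end FSBP

/-! Operators reduce to quadrature. For a closed diagonal-norm operator with `P = diag w`, the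
identity `Q + Qᵀ = B` tested on `f, h ∈ 𝓕` says exactly that `(x, w)` integrates `(f h)'`.
Conversely, a positive closed rule exact on `(𝓕𝓕)'` yields `Q = B/2 + A`, where the skew matrix `A`
is prescribed on the nodal values of `𝓕`; exactness makes the prescription consistent
(`exists_skew_matrix`, `exists_operator`). Nodal values determine `f`: if `f` vanishes at `n + 1`
points, then `(f²)' = 2 f f'` vanishes there and at `n` Rolle points, too many zeros for a
Tchebyshev system of size `2n`, so `f²` is constant and `f = 0`.

The rule comes from the geometry of the moment cone. The moment vector is strictly positive on
nonzero nonnegative combinations. Subtracting the largest admissible multiple of the curve point at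
`t` leaves a boundary point of the cone, carried by the zeros of one nonnegative combination: at
most `n` zeros, fewer than `n` of them interior. With `t = b`, comparison with a second
representation forces `n + 1` nodes including `a` (`exists_lobatto`).

Uniqueness and minimality are a count: two closed rules with at most `n + 1` nodes each share `a`
and `b`, so at most `2n` nodes occur altogether, and point evaluations at `2n` nodes are
independent. -/

namespace FSBP

open Finset

/-! ### Linear dependences and sign patterns of Tchebyshev systems. -/

section Tchebyshev

variable {a b : ℝ} {N : ℕ} {g : Fin N → Set.Icc a b → ℝ}

/-- The combination `∑ c_j g_j`. -/
def comb (g : Fin N → Set.Icc a b → ℝ) (c : Fin N → ℝ) (x : Set.Icc a b) : ℝ :=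
  c ⬝ᵥ fun j => g j x

lemma IsTchebyshevSystem.eq_zero_of_comb (hg : IsTchebyshevSystem g) {x : Fin N → Set.Icc a b}
    (hx : Function.Injective x) {c : Fin N → ℝ} (h : ∀ i, comb g c (x i) = 0) : c = 0 := by
  refine Matrix.eq_zero_of_mulVec_eq_zero (hg.2 x hx) ?_
  ext i
  simpa [Matrix.mulVec, comb, dotProduct_comm] using h i

lemma IsTchebyshevSystem.eq_zero_of_sum (hg : IsTchebyshevSystem g) {x : Fin N → Set.Icc a b}
    (hx : Function.Injective x) {w : Fin N → ℝ} (h : ∀ j, ∑ i, w i * g j (x i) = 0) : w = 0 := by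
  refine Matrix.eq_zero_of_vecMul_eq_zero (hg.2 x hx) ?_
  ext j
  simpa [Matrix.vecMul, dotProduct] using h j

/-- Pad `S` to exactly `N` nodes, with weight zero on the added ones; `a < b` supplies enough
points. -/
lemma IsTchebyshevSystem.eq_zero_of_sum_finset (hab : a < b) (hg : IsTchebyshevSystem g)
    {S : Finset (Set.Icc a b)} (hS : #S ≤ N) {w : Set.Icc a b → ℝ}
    (h : ∀ j, ∑ x ∈ S, w x * g j x = 0) : ∀ x ∈ S, w x = 0 := by
  have : Infinite (Set.Icc a b) := Set.Icc.infinite hab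
  obtain ⟨S', hSS', hc⟩ := Infinite.exists_superset_card_eq S N hS
  let e := S'.orderEmbOfFin hc
  have key : (fun i => if e i ∈ S then w (e i) else 0) = 0 := by
    refine hg.eq_zero_of_sum e.injective fun j => ?_
    calc ∑ i, (if e i ∈ S then w (e i) else 0) * g j (e i)
        = ∑ y ∈ univ.image e, (if y ∈ S then w y else 0) * g j y :=
          (sum_image (f := fun y => (if y ∈ S then w y else 0) * g j y) e.injective.injOn).symm
      _ = ∑ y ∈ S', (if y ∈ S then w y else 0) * g j y := by
          rw [show univ.image e = S' from image_orderEmbOfFin_univ S' hc]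
      _ = ∑ y ∈ S, (if y ∈ S then w y else 0) * g j y :=
          (sum_subset hSS' fun y _ hy => by simp [hy]).symm
      _ = 0 := by
          rw [← h j]
          exact sum_congr rfl fun y hy => by simp [hy]
  intro x hx
  obtain ⟨i, rfl⟩ : x ∈ Set.range e := by simpa [e] using hSS' hx
  simpa [hx] using congrFun key i

lemma IsTchebyshevSystem.continuous_comb (hg : IsTchebyshevSystem g) (c : Fin N → ℝ) :
    Continuous (comb g c) := by
  have := hg.1
  unfold comb dotProduct
  fun_prop

lemma exists_comb_eq_zero (g : Fin N → Set.Icc a b → ℝ) {S : Finset (Set.Icc a b)}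
    (hS : #S < N) : ∃ c ≠ 0, ∀ x ∈ S, comb g c x = 0 := by
  let Φ : (Fin N → ℝ) →ₗ[ℝ] (S → ℝ) :=
    LinearMap.pi fun x => (dotProductBilin ℝ ℝ).flip fun j => g j x
  obtain ⟨c, hc, h0⟩ := Submodule.exists_mem_ne_zero_of_ne_bot
    (LinearMap.ker_ne_bot_of_finrank_lt (f := Φ) (by simpa using hS))
  refine ⟨c, h0, fun x hx => ?_⟩
  exact congrFun (LinearMap.mem_ker.1 hc) ⟨x, hx⟩

/-- Consecutive coefficients of a dependence between `N + 1` point evaluations have opposite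
signs. -/
lemma IsTchebyshevSystem.consecutive_signs (hg : IsTchebyshevSystem g)
    {x : Fin (N + 1) → Set.Icc a b} (hx : StrictMono x) {w : Fin (N + 1) → ℝ}
    (h : ∀ j, ∑ i, w i * g j (x i) = 0) (i : Fin N) :
    ∃ r : ℝ, 0 < r ∧ w i.succ = - r * w i.castSucc := by
  classical
  -- A combination vanishing at the other `N - 1` nodes has no further zero, hence one sign between
  -- the two remaining consecutive nodes; applied to it, the dependence keeps only two terms.
  let S : Finset (Set.Icc a b) := (univ \ {i.castSucc, i.succ}).image x
  have hcard : #(univ \ {i.castSucc, i.succ} : Finset (Fin (N + 1))) = N - 1 := by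
    rw [card_sdiff_of_subset (subset_univ _), card_pair i.castSucc_lt_succ.ne]
    simp
  have hS : #S = N - 1 := by rw [card_image_of_injective _ hx.injective, hcard]
  obtain ⟨c, hc0, hc⟩ := exists_comb_eq_zero g (S := S) (by have := i.pos; omega)
  have hne : ∀ t, t ∉ S → comb g c t ≠ 0 := by
    intro t ht h0
    have hcS : #(insert t S) = N := by rw [card_insert_of_notMem ht, hS]; have := i.pos; omega
    refine hc0 (hg.eq_zero_of_comb ((insert t S).orderEmbOfFin hcS).injective fun k => ?_)
    have hk := (insert t S).orderEmbOfFin_mem hcS k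
    rcases mem_insert.1 hk with hk | hk
    · rw [hk, h0]
    · exact hc _ hk
  have hgap : ∀ t, x i.castSucc ≤ t → t ≤ x i.succ → t ∉ S := by
    intro t h1 h2 ht
    obtain ⟨k, hk, rfl⟩ := mem_image.1 ht
    rw [hx.le_iff_le] at h1 h2
    simp only [mem_sdiff, mem_univ, mem_insert, mem_singleton, true_and, not_or] at hk
    have h3 := lt_of_le_of_ne h1 (Ne.symm hk.1)
    exact hk.2 (le_antisymm h2 (Fin.castSucc_lt_iff_succ_le.1 h3))
  have hlt := hx i.castSucc_lt_succ
  have hpos : 0 < comb g c (x i.castSucc) * comb g c (x i.succ) := by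
    have hA := hne _ (hgap _ le_rfl hlt.le)
    have hB := hne _ (hgap _ hlt.le le_rfl)
    by_contra hcon
    have hle := lt_of_le_of_ne (not_lt.1 hcon) (mul_ne_zero hA hB)
    have hab : a ≤ b := (x i.succ).2.1.trans (x i.succ).2.2
    let f : ℝ → ℝ := fun t => comb g c (Set.projIcc a b hab t)
    have hf : ∀ y : Set.Icc a b, f y = comb g c y := fun y => by simp [f]
    have hsub : (0 : ℝ) ∈ f '' Set.Icc (x i.castSucc : ℝ) (x i.succ) := by
      have hco : ContinuousOn f (Set.Icc (x i.castSucc : ℝ) (x i.succ)) :=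
        ((hg.continuous_comb c).comp continuous_projIcc).continuousOn
      rcases mul_neg_iff.1 hle with ⟨h1, h2⟩ | ⟨h1, h2⟩
      · exact intermediate_value_Icc' (Subtype.coe_le_coe.2 hlt.le) hco
          ⟨by rw [hf]; exact h2.le, by rw [hf]; exact h1.le⟩
      · exact intermediate_value_Icc (Subtype.coe_le_coe.2 hlt.le) hco
          ⟨by rw [hf]; exact h1.le, by rw [hf]; exact h2.le⟩
    obtain ⟨t, ht, h0⟩ := hsub
    have htab : t ∈ Set.Icc a b := ⟨(x i.castSucc).2.1.trans ht.1, ht.2.trans (x i.succ).2.2⟩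
    exact hne ⟨t, htab⟩ (hgap _ ht.1 ht.2) (by rw [← hf]; exact h0)
  have hsum : ∑ k, w k * comb g c (x k) = 0 := by
    simp only [comb, dotProduct, mul_sum]
    rw [sum_comm]
    refine sum_eq_zero fun j _ => ?_
    have := congrArg (c j * ·) (h j)
    simp only [mul_sum, mul_zero] at this
    rw [← this]
    exact sum_congr rfl fun k _ => by ring
  rw [← sum_sdiff (subset_univ {i.castSucc, i.succ}), sum_pair i.castSucc_lt_succ.ne,
    sum_eq_zero fun k hk => by rw [hc _ (mem_image_of_mem x hk), mul_zero], zero_add] at hsum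
  have hB : comb g c (x i.succ) ≠ 0 := hne _ (hgap _ hlt.le le_rfl)
  refine ⟨comb g c (x i.castSucc) / comb g c (x i.succ), ?_, ?_⟩
  · rw [← mul_div_mul_right _ _ hB]
    exact div_pos hpos (mul_self_pos.2 hB)
  · field_simp
    linarith

/-- Weakly alternating values at `N + 1` points force a combination to vanish. -/
lemma IsTchebyshevSystem.eq_zero_of_alternating (hg : IsTchebyshevSystem g)
    {x : Fin (N + 1) → Set.Icc a b} (hx : StrictMono x) {c : Fin N → ℝ}
    (h : ∀ i : Fin (N + 1), 0 ≤ (-1) ^ (i : ℕ) * comb g c (x i)) : c = 0 := by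
  obtain ⟨w, hw, h0⟩ : ∃ w : Fin (N + 1) → ℝ, (∀ j, ∑ i, w i * g j (x i) = 0) ∧ w ≠ 0 := by
    let Φ : (Fin (N + 1) → ℝ) →ₗ[ℝ] (Fin N → ℝ) :=
      LinearMap.pi fun j => (dotProductBilin ℝ ℝ).flip fun i => g j (x i)
    obtain ⟨w, hw, h0⟩ := Submodule.exists_mem_ne_zero_of_ne_bot
      (LinearMap.ker_ne_bot_of_finrank_lt (f := Φ) (by simp))
    exact ⟨w, fun j => congrFun (LinearMap.mem_ker.1 hw) j, h0⟩
  have hstep : ∀ i, ∃ r : ℝ, 0 < r ∧ w i = (-1) ^ (i : ℕ) * r * w 0 := by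
    intro i
    induction i using Fin.induction with
    | zero => exact ⟨1, one_pos, by simp⟩
    | succ i ih =>
      obtain ⟨r, hr, e⟩ := ih
      obtain ⟨s, hs, e'⟩ := hg.consecutive_signs hx hw i
      refine ⟨s * r, mul_pos hs hr, ?_⟩
      rw [e', e]
      simp only [Fin.val_castSucc, Fin.val_succ, pow_succ]
      ring
  have hw0 : w 0 ≠ 0 := fun hz => h0 <| funext fun i => by
    obtain ⟨r, -, e⟩ := hstep i
    simp [e, hz]
  -- The dependence has strictly alternating coefficients, so paired with weakly alternating values
  -- it becomes a vanishing sum of nonnegative terms.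
  choose r hr e using hstep
  have hsum : ∑ k : Fin (N + 1), r k * ((-1) ^ (k : ℕ) * comb g c (x k)) = 0 := by
    have : w 0 * ∑ k : Fin (N + 1), r k * ((-1) ^ (k : ℕ) * comb g c (x k)) = 0 := by
      calc _ = ∑ k, w k * comb g c (x k) := by
            rw [mul_sum]
            exact sum_congr rfl fun k _ => by rw [e k]; ring
        _ = ∑ j, c j * ∑ k, w k * g j (x k) := by
            simp only [comb, dotProduct, mul_sum]
            rw [sum_comm]
            exact sum_congr rfl fun k _ => sum_congr rfl fun j _ => by ring
        _ = 0 := by simp [hw]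
    exact (mul_eq_zero.1 this).resolve_left hw0
  rw [sum_eq_zero_iff_of_nonneg fun k _ => mul_nonneg (hr k).le (h k)] at hsum
  refine hg.eq_zero_of_comb (x := fun i => x i.castSucc)
    (hx.injective.comp (Fin.castSucc_injective N)) fun i => ?_
  have := hsum i.castSucc (mem_univ _)
  simpa [(hr _).ne'] using this

/-- The curve traced by a Tchebyshev system does not have the origin in its convex hull. -/
lemma IsTchebyshevSystem.zero_notMem_convexHull (hab : a < b) (hN : 0 < N)
    (hg : IsTchebyshevSystem g) :
    (0 : Fin N → ℝ) ∉ convexHull ℝ (Set.range fun x j => g j x) := by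
  classical
  intro h0
  obtain ⟨ι, _, z, w, hz, hind, hw, hw1, hsum⟩ := eq_pos_convex_span_of_mem_convexHull h0
  choose x hx using fun i => hz (Set.mem_range_self i)
  have hinj : Function.Injective x := fun i j hij => hind.injective (by rw [← hx, ← hx, hij])
  have hrel : ∀ j, ∑ i, w i * g j (x i) = 0 := by
    intro j
    have := congrFun hsum j
    simpa [Finset.sum_apply, ← hx] using this
  have hne : (univ : Finset ι).Nonempty := by
    by_contra hcon
    rw [not_nonempty_iff_eq_empty] at hcon
    simp [hcon] at hw1
  have hle : Fintype.card ι ≤ N + 1 := by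
    simpa using hind.card_le_finrank_succ.trans
      (Nat.succ_le_succ (Submodule.finrank_le _))
  -- Carathéodory leaves at most `N + 1` points with positive weights. Up to `N` points are
  -- independent; for `N + 1` points consecutive weights would have opposite signs.
  rcases hle.lt_or_eq with hlt | heq
  · let W : Set.Icc a b → ℝ := Function.extend x w 0
    have hW : ∀ i, W (x i) = w i := fun i => hinj.extend_apply w 0 i
    obtain ⟨i, -⟩ := hne
    have := hg.eq_zero_of_sum_finset hab (S := univ.image x) (w := W)
      (by rw [card_image_of_injective _ hinj]; simpa using Nat.lt_succ_iff.1 hlt)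
      (fun j => by
        rw [sum_image hinj.injOn]
        simpa [hW] using hrel j) (x i) (mem_image_of_mem _ (mem_univ _))
    rw [hW] at this
    exact (hw i).ne' this
  · have hcS : #(univ.image x) = N + 1 := by rw [card_image_of_injective _ hinj]; simpa using heq
    let e := (univ.image x).orderEmbOfFin hcS
    let W : Set.Icc a b → ℝ := Function.extend x w 0
    have hW : ∀ i, W (x i) = w i := fun i => hinj.extend_apply w 0 i
    have hWpos : ∀ k, 0 < W (e k) := by
      intro k
      obtain ⟨i, -, hi⟩ := mem_image.1 ((univ.image x).orderEmbOfFin_mem hcS k)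
      change 0 < W ((univ.image x).orderEmbOfFin hcS k)
      rw [← hi, hW]
      exact hw i
    obtain ⟨r, hr, he⟩ := hg.consecutive_signs e.strictMono (w := fun k => W (e k))
      (fun j => by
        rw [← hrel j, ← sum_image (s := univ) (g := e) (f := fun y => W y * g j y)
          e.injective.injOn, show univ.image e = univ.image x from image_orderEmbOfFin_univ _ hcS,
          sum_image hinj.injOn]
        simp [hW]) ⟨0, hN⟩
    have h1 := hWpos (Fin.succ ⟨0, hN⟩)
    rw [he] at h1
    nlinarith [hWpos (Fin.castSucc ⟨0, hN⟩)]

/-- The parity of the position is recorded because sign alternation is read off from it. -/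
lemma exists_interleave {α : Type*} [Preorder α] {n : ℕ} {z : Fin (n + 1) → α} {p : Fin n → α}
    (h₁ : ∀ i, z i.castSucc < p i) (h₂ : ∀ i, p i < z i.succ) :
    ∃ y : Fin (2 * n + 1) → α, StrictMono y ∧
      ∀ i : Fin (2 * n + 1), (Even (i : ℕ) ∧ ∃ k, y i = z k) ∨ (Odd (i : ℕ) ∧ ∃ k, y i = p k) := by
  let y : Fin (2 * n + 1) → α := fun i =>
    if h : (i : ℕ) % 2 = 0 then z ⟨i / 2, by omega⟩ else p ⟨i / 2, by omega⟩
  refine ⟨y, Fin.strictMono_iff_lt_succ.2 fun i => ?_, fun i => ?_⟩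
  · by_cases h : (i : ℕ) % 2 = 0
    · have h' : ¬ ((i : ℕ) + 1) % 2 = 0 := by omega
      have h3 : ((i : ℕ) + 1) / 2 = i / 2 := by omega
      simpa [y, h, h', h3, Fin.castSucc, Fin.castAdd, Fin.castLE] using h₁ ⟨i / 2, by omega⟩
    · have h' : ((i : ℕ) + 1) % 2 = 0 := by omega
      have h3 : ((i : ℕ) + 1) / 2 = i / 2 + 1 := by omega
      simpa [y, h, h', h3, Fin.succ] using h₂ ⟨i / 2, by omega⟩
  · by_cases h : (i : ℕ) % 2 = 0
    · exact Or.inl ⟨Nat.even_iff.2 h, _, dif_pos h⟩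
    · exact Or.inr ⟨Nat.odd_iff.2 (by omega), _, dif_neg h⟩

end Tchebyshev

/-! ### Zeros of nonnegative combinations. -/

section Zeros

variable {a b : ℝ} {n : ℕ} {g : Fin (2 * n) → Set.Icc a b → ℝ}

/-- Interleaving `n + 1` zeros with `n` points between them gives `2n + 1` points where `-c`
alternates weakly. This replaces counting double zeros and needs no derivatives. -/
lemma IsTchebyshevSystem.card_zeros_le (hg : IsTchebyshevSystem g) {c : Fin (2 * n) → ℝ}
    (hc : c ≠ 0) (hpos : ∀ x, 0 ≤ comb g c x) {Z : Finset (Set.Icc a b)}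
    (hZ : ∀ x ∈ Z, comb g c x = 0) : #Z ≤ n := by
  by_contra! hcon
  obtain ⟨Z', hZ', hcard⟩ := exists_subset_card_eq (Nat.succ_le_of_lt hcon)
  let z := Z'.orderEmbOfFin hcard
  have hz : ∀ i, comb g c (z i) = 0 := fun i => hZ _ (hZ' (Z'.orderEmbOfFin_mem hcard i))
  choose p hp using fun i : Fin n => exists_between (z.strictMono i.castSucc_lt_succ)
  obtain ⟨y, hy, hyy⟩ := exists_interleave (fun i => (hp i).1) (fun i => (hp i).2)
  refine hc (neg_eq_zero.1 (hg.eq_zero_of_alternating hy fun i : Fin (2 * n + 1) => ?_))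
  have hneg : comb g (-c) (y i) = - comb g c (y i) := by simp [comb]
  rcases hyy i with ⟨-, k, hk⟩ | ⟨ho, k, hk⟩
  · rw [hneg, hk, hz]; simp
  · rw [hneg, ho.neg_one_pow]; simpa using hpos _

/-- Around `n` interior zeros there is room for `n + 1` separating points, again `2n + 1` in all.
The endpoints are inserted only to provide the two outer gaps. -/
lemma IsTchebyshevSystem.card_interior_zeros_lt (hab : a < b) (hg : IsTchebyshevSystem g)
    {c : Fin (2 * n) → ℝ} (hc : c ≠ 0) (hpos : ∀ x, 0 ≤ comb g c x) {Z : Finset (Set.Icc a b)}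
    (hZ : ∀ x ∈ Z, comb g c x = 0) (hint : ∀ x ∈ Z, (x : ℝ) ≠ a ∧ (x : ℝ) ≠ b) : #Z < n := by
  by_contra! hcon
  obtain ⟨Z', hZ', hcard⟩ := exists_subset_card_eq hcon
  have ha : a ∈ Set.Icc a b := ⟨le_rfl, hab.le⟩
  have hb : b ∈ Set.Icc a b := ⟨hab.le, le_rfl⟩
  have hcS : #(insert ⟨a, ha⟩ (insert ⟨b, hb⟩ Z')) = n + 2 := by
    rw [card_insert_of_notMem, card_insert_of_notMem, hcard]
    · exact fun h => (hint _ (hZ' h)).2 rfl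
    · rw [mem_insert, not_or]
      exact ⟨fun h => hab.ne (congrArg Subtype.val h), fun h => (hint _ (hZ' h)).1 rfl⟩
  let z := (insert ⟨a, ha⟩ (insert ⟨b, hb⟩ Z')).orderEmbOfFin hcS
  have hz : ∀ i : Fin n, comb g c (z i.castSucc.succ) = 0 := by
    intro i
    have hmem := (insert ⟨a, ha⟩ (insert ⟨b, hb⟩ Z')).orderEmbOfFin_mem hcS i.castSucc.succ
    have h1 : z 0 < z i.castSucc.succ := z.strictMono (Fin.succ_pos _)
    have h2 : z i.castSucc.succ < z (Fin.last _) := z.strictMono (by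
      rw [Fin.lt_def]; simp)
    rcases mem_insert.1 hmem with h | h
    · exact absurd ((z 0).2.1) (not_le.2 (by
        have := Subtype.coe_lt_coe.2 h1
        rwa [show z i.castSucc.succ = _ from h] at this))
    rcases mem_insert.1 h with h | h
    · exact absurd ((z (Fin.last _)).2.2) (not_le.2 (by
        have := Subtype.coe_lt_coe.2 h2
        rwa [show z i.castSucc.succ = _ from h] at this))
    · exact hZ _ (hZ' h)
  choose p hp using fun i : Fin (n + 1) => exists_between (z.strictMono i.castSucc_lt_succ)
  obtain ⟨y, hy, hyy⟩ := exists_interleave (z := p) (p := fun i : Fin n => z i.castSucc.succ)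
    (fun i => (hp i.castSucc).2) (fun i => by simpa using (hp i.succ).1)
  refine hc (hg.eq_zero_of_alternating hy fun i : Fin (2 * n + 1) => ?_)
  rcases hyy i with ⟨he, k, hk⟩ | ⟨-, k, hk⟩
  · rw [he.neg_one_pow]; simpa using hpos _
  · rw [hk, hz]; simp

end Zeros

/-! ### Conic representations over a compact curve. -/

section Cone

lemma isCompact_convexHull_of_isCompact {E : Type*} [NormedAddCommGroup E] [NormedSpace ℝ E]
    [FiniteDimensional ℝ E] {s : Set E} (hs : IsCompact s) : IsCompact (convexHull ℝ s) := by
  rcases s.eq_empty_or_nonempty with rfl | ⟨y₀, hy₀⟩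
  · simp
  let k := Module.finrank ℝ E + 1
  -- By Carathéodory the hull is the image under `Φ` of a compact set; slots not needed get weight
  -- zero and the filler point `y₀`.
  let Φ : (Fin k → ℝ) × (Fin k → E) → E := fun p => ∑ i, p.1 i • p.2 i
  have hΦ : Continuous Φ := by fun_prop
  have : convexHull ℝ s = Φ '' (stdSimplex ℝ (Fin k) ×ˢ Set.univ.pi fun _ => s) := by
    refine Set.Subset.antisymm (fun y hy => ?_) ?_
    · obtain ⟨ι, _, z, w, hz, hind, hw, hw1, hsum⟩ := eq_pos_convex_span_of_mem_convexHull hy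
      have hle : Fintype.card ι ≤ k :=
        hind.card_le_finrank_succ.trans (Nat.succ_le_succ (Submodule.finrank_le _))
      obtain ⟨e⟩ : Nonempty (ι ↪ Fin k) := Function.Embedding.nonempty_of_card_le (by simpa)
      have hsupp : ∀ i ∉ Set.range e, Function.extend e w 0 i = 0 := fun i hi => by
        rw [Function.extend_apply' _ _ _ (by simpa using hi)]; rfl
      refine ⟨(Function.extend e w 0, Function.extend e z fun _ => y₀), ⟨⟨fun i => ?_, ?_⟩, ?_⟩, ?_⟩
      · by_cases hi : i ∈ Set.range e
        · obtain ⟨i, rfl⟩ := hi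
          simpa only [e.injective.extend_apply] using (hw i).le
        · exact (hsupp i hi).ge
      · rw [← hw1]
        refine (Fintype.sum_of_injective e e.injective _ _ hsupp fun i => ?_).symm
        rw [e.injective.extend_apply]
      · intro i _
        by_cases hi : i ∈ Set.range e
        · obtain ⟨i, rfl⟩ := hi
          simpa only [e.injective.extend_apply] using hz (Set.mem_range_self i)
        · simpa only [Function.extend_apply' _ _ _ (show ¬ ∃ a, e a = i by simpa using hi)] using hy₀
      · rw [← hsum]
        refine (Fintype.sum_of_injective e e.injective _ _ (fun i hi => ?_) fun i => ?_).symm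
        · simp only [hsupp i hi, zero_smul]
        · simp only [e.injective.extend_apply]
    · rintro _ ⟨⟨w, z⟩, ⟨hw, hz⟩, rfl⟩
      exact (convex_convexHull ℝ s).sum_mem (fun i _ => hw.1 i) hw.2
        fun i _ => subset_convexHull ℝ s (hz i (Set.mem_univ i))
  rw [this]
  exact ((isCompact_stdSimplex ℝ (Fin k)).prod (isCompact_univ_pi fun _ => hs)).image hΦ

variable {X : Type*} [TopologicalSpace X] [CompactSpace X] {N : ℕ} {γ : X → Fin N → ℝ}

/-- If some functional is strictly positive along a compact curve, every vector on which all
functionals nonnegative along the curve are nonnegative lies in the cone spanned by the curve. -/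
lemma exists_conic_representation (hγ : Continuous γ) {v M : Fin N → ℝ}
    (hv : ∀ x, 0 < v ⬝ᵥ γ x) (hM : ∀ u : Fin N → ℝ, (∀ x, 0 ≤ u ⬝ᵥ γ x) → 0 ≤ u ⬝ᵥ M) :
    ∃ (Z : Finset X) (w : X → ℝ), (∀ z ∈ Z, 0 < w z) ∧ ∑ z ∈ Z, w z • γ z = M := by
  classical
  have hcont : ∀ u : Fin N → ℝ, Continuous fun x => u ⬝ᵥ γ x := fun u =>
    continuous_const.dotProduct hγ
  rcases (hM v fun x => (hv x).le).eq_or_lt with h0 | h0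
  -- Subtracting a suitable multiple of `v` makes any `u` nonnegative on the curve without changing
  -- its value at `M`; hence `M = 0`.
  · have hnn : ∀ u : Fin N → ℝ, 0 ≤ u ⬝ᵥ M := by
      intro u
      have hq : Continuous fun x => u ⬝ᵥ γ x / v ⬝ᵥ γ x :=
        (hcont u).div (hcont v) fun x => (hv x).ne'
      obtain ⟨R, hR⟩ := (isCompact_range hq).bddBelow
      have := hM (u - R • v) fun x => by
        have h1 : R ≤ u ⬝ᵥ γ x / v ⬝ᵥ γ x := hR ⟨x, rfl⟩
        rw [le_div_iff₀ (hv x)] at h1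
        rw [sub_dotProduct, smul_dotProduct, smul_eq_mul]
        linarith
      rwa [sub_dotProduct, smul_dotProduct, ← h0, smul_zero, sub_zero] at this
    refine ⟨∅, 0, by simp, ?_⟩
    rw [sum_empty, eq_comm]
    have h1 := hnn (-M)
    rw [neg_dotProduct] at h1
    exact dotProduct_self_eq_zero.1 (le_antisymm (by linarith) (hnn M))
  -- Rescaling the curve into the hyperplane where `v` equals `1` turns the cone into a compact
  -- convex set, to which separation applies.
  · let η : X → Fin N → ℝ := fun x => (v ⬝ᵥ γ x)⁻¹ • γ x
    have hη : Continuous η := ((hcont v).inv₀ fun x => (hv x).ne').smul hγ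
    have hmem : (v ⬝ᵥ M)⁻¹ • M ∈ convexHull ℝ (Set.range η) := by
      by_contra hcon
      obtain ⟨f, s, hs, hf⟩ := geometric_hahn_banach_point_closed (convex_convexHull ℝ _)
        (isCompact_convexHull_of_isCompact (isCompact_range hη)).isClosed hcon
      let u : Fin N → ℝ := fun j => f (Pi.single j 1)
      have hfu : ∀ y, f y = u ⬝ᵥ y := by
        intro y
        conv_lhs => rw [pi_eq_sum_univ' y, map_sum]
        refine sum_congr rfl fun j _ => ?_
        rw [map_smul, smul_eq_mul, mul_comm]
      have hu := hM (u - s • v) fun x => by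
        have h1 := hf (η x) (subset_convexHull ℝ _ ⟨x, rfl⟩)
        rw [hfu, dotProduct_smul, smul_eq_mul, inv_mul_eq_div, lt_div_iff₀ (hv x)] at h1
        rw [sub_dotProduct, smul_dotProduct, smul_eq_mul]
        linarith
      rw [hfu, dotProduct_smul, smul_eq_mul, inv_mul_eq_div, div_lt_iff₀ h0] at hs
      rw [sub_dotProduct, smul_dotProduct, smul_eq_mul] at hu
      linarith
    obtain ⟨ι, _, z, w, hz, hind, hw, -, hsum⟩ := eq_pos_convex_span_of_mem_convexHull hmem
    choose x hx using fun i => hz (Set.mem_range_self i)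
    have hinj : Function.Injective x := fun i j hij => hind.injective (by rw [← hx, ← hx, hij])
    refine ⟨univ.image x, Function.extend x (fun i => v ⬝ᵥ M * (w i * (v ⬝ᵥ γ (x i))⁻¹)) 0,
      ?_, ?_⟩
    · intro y hy
      obtain ⟨i, -, rfl⟩ := mem_image.1 hy
      rw [hinj.extend_apply]
      exact mul_pos h0 (mul_pos (hw i) (inv_pos.2 (hv _)))
    · rw [sum_image hinj.injOn]
      simp only [hinj.extend_apply, mul_smul]
      rw [← smul_sum]
      have : ∀ i, w i • (v ⬝ᵥ γ (x i))⁻¹ • γ (x i) = w i • z i := fun i => by rw [← hx]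
      rw [sum_congr rfl fun i _ => this i, hsum, smul_inv_smul₀ h0.ne']

/-- Splitting off the largest possible multiple of `γ t` from a strictly positive moment
vector. -/
lemma exists_representation_through (hγ : Continuous γ) {v c : Fin N → ℝ}
    (hv : ∀ x, 0 < v ⬝ᵥ γ x)
    (hc : ∀ u : Fin N → ℝ, u ≠ 0 → (∀ x, 0 ≤ u ⬝ᵥ γ x) → 0 < u ⬝ᵥ c) (t : X) :
    ∃ u : Fin N → ℝ, u ≠ 0 ∧ (∀ x, 0 ≤ u ⬝ᵥ γ x) ∧ ∃ (r : ℝ) (Z : Finset X) (w : X → ℝ),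
      0 < r ∧ t ∉ Z ∧ (∀ z ∈ Z, 0 < w z) ∧ (∀ z ∈ Z, u ⬝ᵥ γ z = 0) ∧
      r • γ t + ∑ z ∈ Z, w z • γ z = c := by
  have hv0 : v ≠ 0 := fun h => (hv t).ne' (by simp [h])
  let K : Set (Fin N → ℝ) := {u | ∀ x, 0 ≤ u ⬝ᵥ γ x} ∩ Metric.sphere 0 1
  have hK : IsCompact K := by
    refine (isCompact_sphere _ _).inter_left ?_
    rw [Set.ofPred_forall]
    exact isClosed_iInter fun x => isClosed_le continuous_const
      (continuous_id.dotProduct continuous_const)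
  have hK0 : ∀ u ∈ K, u ≠ 0 := by
    rintro u ⟨-, hu⟩ rfl
    simp at hu
  have hKc : ∀ u ∈ K, 0 < u ⬝ᵥ c := fun u hu => hc u (hK0 u hu) hu.1
  have hscale : ∀ u : Fin N → ℝ, u ≠ 0 → (∀ x, 0 ≤ u ⬝ᵥ γ x) → ‖u‖⁻¹ • u ∈ K := by
    refine fun u hu h => ⟨fun x => ?_, ?_⟩
    · rw [smul_dotProduct]
      exact mul_nonneg (by positivity) (h x)
    · rw [mem_sphere_zero_iff_norm, norm_smul, norm_inv, norm_norm,
        inv_mul_cancel₀ (norm_ne_zero_iff.2 hu)]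
  have hcd : ∀ y : Fin N → ℝ, Continuous fun u : Fin N → ℝ => u ⬝ᵥ y := fun y =>
    continuous_id.dotProduct continuous_const
  -- `c - r • γ t` stays in the cone exactly while `r` times this ratio is at most `1` for all
  -- admissible functionals. The largest such `r` is `μ⁻¹`, and the maximiser `u` supports the cone
  -- at the remainder.
  obtain ⟨u, huK, hmax⟩ := hK.exists_isMaxOn ⟨_, hscale v hv0 fun x => (hv x).le⟩
    (f := fun u => u ⬝ᵥ γ t / u ⬝ᵥ c)
    ((hcd _).continuousOn.div (hcd _).continuousOn fun u hu => (hKc u hu).ne')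
  set μ := u ⬝ᵥ γ t / u ⬝ᵥ c with hμ
  have hle : ∀ y : Fin N → ℝ, y ≠ 0 → (∀ x, 0 ≤ y ⬝ᵥ γ x) → y ⬝ᵥ γ t / y ⬝ᵥ c ≤ μ := by
    intro y hy h
    have h1 : (‖y‖⁻¹ • y) ⬝ᵥ γ t / (‖y‖⁻¹ • y) ⬝ᵥ c ≤ μ := hmax (hscale y hy h)
    rwa [smul_dotProduct, smul_dotProduct, smul_eq_mul, smul_eq_mul,
      mul_div_mul_left _ _ (inv_ne_zero (norm_ne_zero_iff.2 hy))] at h1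
  have hμ0 : 0 < μ := lt_of_lt_of_le
    (div_pos (hv t) (hc v hv0 fun x => (hv x).le)) (hle v hv0 fun x => (hv x).le)
  have huc := hKc u huK
  have hut : u ⬝ᵥ γ t = μ * u ⬝ᵥ c := by rw [hμ]; field_simp
  obtain ⟨Z, w, hw, hsum⟩ := exists_conic_representation hγ hv (M := c - μ⁻¹ • γ t) (by
    intro y h
    rcases eq_or_ne y 0 with rfl | hy
    · simp
    have h1 := hle y hy h
    rw [div_le_iff₀ (hc y hy h)] at h1
    rw [dotProduct_sub, dotProduct_smul, smul_eq_mul, sub_nonneg, inv_mul_le_iff₀ hμ0]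
    exact h1)
  have hzero : ∀ z ∈ Z, u ⬝ᵥ γ z = 0 := by
    have h0 : ∑ z ∈ Z, w z * u ⬝ᵥ γ z = 0 := by
      have := congrArg (u ⬝ᵥ ·) hsum
      simp only [dotProduct_sum, dotProduct_smul, dotProduct_sub, smul_eq_mul, hut,
        inv_mul_cancel_left₀ hμ0.ne', sub_self] at this
      exact this
    intro z hz
    have := (sum_eq_zero_iff_of_nonneg fun z hz => mul_nonneg (hw z hz).le (huK.1 z)).1 h0 z hz
    exact (mul_eq_zero.1 this).resolve_left (hw z hz).ne'
  refine ⟨u, hK0 u huK, huK.1, μ⁻¹, Z, w, inv_pos.2 hμ0, fun ht => ?_, hw, hzero, ?_⟩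
  · have := hzero t ht
    rw [hut] at this
    exact (mul_pos hμ0 huc).ne' this
  · rw [hsum]; abel

end Cone

/-! ### Existence of the Lobatto representation. -/

section Quadrature

variable {a b : ℝ} {n : ℕ} {g : Fin (2 * n) → Set.Icc a b → ℝ} {c : Fin (2 * n) → ℝ}

lemma IsTchebyshevSystem.exists_representation_through (hab : a < b) (hn : 1 ≤ n)
    (hg : IsTchebyshevSystem g)
    (hc : ∀ u : Fin (2 * n) → ℝ, u ≠ 0 → (∀ x, 0 ≤ comb g u x) → 0 < u ⬝ᵥ c)
    (t : Set.Icc a b) :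
    ∃ (r : ℝ) (Z : Finset (Set.Icc a b)) (w : Set.Icc a b → ℝ),
      0 < r ∧ t ∉ Z ∧ (∀ z ∈ Z, 0 < w z) ∧ #Z ≤ n ∧
      #(Finset.filter (fun z : Set.Icc a b => (z : ℝ) ≠ a ∧ (z : ℝ) ≠ b) Z) < n ∧
      ∀ j, r * g j t + ∑ z ∈ Z, w z * g j z = c j := by
  have hγ : Continuous fun (x : Set.Icc a b) j => g j x := continuous_pi hg.1
  obtain ⟨v, hv⟩ : ∃ v : Fin (2 * n) → ℝ, ∀ x, 0 < v ⬝ᵥ fun j => g j x := by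
    obtain ⟨f, s, hs, hf⟩ := geometric_hahn_banach_point_closed (convex_convexHull ℝ _)
      (isCompact_convexHull_of_isCompact (isCompact_range hγ)).isClosed (hg.zero_notMem_convexHull hab (by omega))
    refine ⟨fun j => f (Pi.single j 1), fun x => ?_⟩
    have h1 := hf _ (subset_convexHull ℝ _ ⟨x, rfl⟩)
    rw [map_zero] at hs
    have h2 : f (fun j => g j x) = (fun j => f (Pi.single j 1)) ⬝ᵥ fun j => g j x := by
      conv_lhs => rw [pi_eq_sum_univ' (fun j => g j x), map_sum]
      refine sum_congr rfl fun j _ => ?_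
      rw [map_smul, smul_eq_mul, mul_comm]
    rw [← h2]
    exact hs.trans h1
  obtain ⟨u, hu0, hu, r, Z, w, hr, ht, hw, hz, hsum⟩ :=
    FSBP.exists_representation_through hγ hv hc t
  refine ⟨r, Z, w, hr, ht, hw, hg.card_zeros_le hu0 hu hz,
    hg.card_interior_zeros_lt hab hu0 hu (fun x hx => hz x (mem_filter.1 hx).1)
      (fun x hx => (mem_filter.1 hx).2), fun j => ?_⟩
  simpa [Finset.sum_apply] using congrFun hsum j

/-- Two representations of the same moments with at most `2 n` nodes altogether coincide. -/
lemma IsTchebyshevSystem.weights_eq (hab : a < b) (hg : IsTchebyshevSystem g)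
    {S T : Finset (Set.Icc a b)} {w w' : Set.Icc a b → ℝ} (hST : #(S ∪ T) ≤ 2 * n)
    (hS : ∀ j, ∑ z ∈ S, w z * g j z = c j) (hT : ∀ j, ∑ z ∈ T, w' z * g j z = c j) :
    ∀ z ∈ S ∪ T, (if z ∈ S then w z else 0) = if z ∈ T then w' z else 0 := by
  intro z hz
  refine sub_eq_zero.1 (hg.eq_zero_of_sum_finset hab hST
    (w := fun z => (if z ∈ S then w z else 0) - if z ∈ T then w' z else 0) (fun j => ?_) z hz)
  have hext : ∀ (U : Finset (Set.Icc a b)) (ω : Set.Icc a b → ℝ), U ⊆ S ∪ T →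
      ∑ z ∈ S ∪ T, (if z ∈ U then ω z else 0) * g j z = ∑ z ∈ U, ω z * g j z := by
    intro U ω hU
    rw [← sum_subset hU fun y _ hy => by simp [hy]]
    exact sum_congr rfl fun y hy => by simp [hy]
  simp only [sub_mul, sum_sub_distrib]
  rw [hext S w subset_union_left, hext T w' subset_union_right, hS, hT, sub_self]

lemma IsTchebyshevSystem.exists_lobatto (hab : a < b) (hn : 1 ≤ n) (hg : IsTchebyshevSystem g)
    (hc : ∀ u : Fin (2 * n) → ℝ, u ≠ 0 → (∀ x, 0 ≤ comb g u x) → 0 < u ⬝ᵥ c) :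
    ∃ (S : Finset (Set.Icc a b)) (w : Set.Icc a b → ℝ), #S = n + 1 ∧
      (⟨a, Set.left_mem_Icc.2 hab.le⟩ : Set.Icc a b) ∈ S ∧ (⟨b, Set.right_mem_Icc.2 hab.le⟩ : Set.Icc a b) ∈ S ∧
      (∀ z ∈ S, 0 < w z) ∧ ∀ j, ∑ z ∈ S, w z * g j z = c j := by
  set A : Set.Icc a b := ⟨a, Set.left_mem_Icc.2 hab.le⟩ with hA
  set B : Set.Icc a b := ⟨b, Set.right_mem_Icc.2 hab.le⟩ with hB
  have key : ∀ t, ∃ (S : Finset (Set.Icc a b)) (w : Set.Icc a b → ℝ), t ∈ S ∧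
      (∀ z ∈ S, 0 < w z) ∧ #S ≤ n + 1 ∧
      #(Finset.filter (fun z : Set.Icc a b => (z : ℝ) ≠ a ∧ (z : ℝ) ≠ b) (S.erase t)) < n ∧
      ∀ j, ∑ z ∈ S, w z * g j z = c j := by
    intro t
    obtain ⟨r, Z, w, hr, ht, hw, hZ, hZi, hsum⟩ :=
      hg.exists_representation_through hab hn hc t
    have hne : ∀ z ∈ Z, z ≠ t := fun z hz h => ht (h ▸ hz)
    refine ⟨insert t Z, Function.update w t r, mem_insert_self _ _, fun z hz => ?_, ?_, ?_,
      fun j => ?_⟩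
    · rcases mem_insert.1 hz with rfl | hz
      · simpa using hr
      · rw [Function.update_of_ne (hne z hz)]
        exact hw z hz
    · rw [card_insert_of_notMem ht]; omega
    · rwa [erase_insert ht]
    · rw [sum_insert ht, ← hsum, Function.update_self]
      congr 1
      exact sum_congr rfl fun z hz => by rw [Function.update_of_ne (hne z hz)]
  obtain ⟨S, w, hBS, hw, hS, hSi, hsum⟩ := key B
  have hcard : n + 1 ≤ #S := by
    by_contra! hlt
    have : Infinite (Set.Icc a b) := Set.Icc.infinite hab
    -- With this `t`, every endpoint lies in `S` or equals `t`, so a representation through `t` adds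
    -- at most `n` nodes to the at most `n` of `S`. The two must coincide, yet only one charges `t`.
    obtain ⟨t, htS, hAt⟩ : ∃ t, t ∉ S ∧ (A ∈ S ∨ A = t) := by
      by_cases h : A ∈ S
      · obtain ⟨t, ht⟩ := Infinite.exists_notMem_finset S
        exact ⟨t, ht, Or.inl h⟩
      · exact ⟨A, h, Or.inr rfl⟩
    obtain ⟨T, w', htT, hw', -, hTi, hsum'⟩ := key t
    have hsub : T \ S ⊆ insert t
        (Finset.filter (fun z : Set.Icc a b => (z : ℝ) ≠ a ∧ (z : ℝ) ≠ b) (T.erase t)) := by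
      intro z hz
      rw [mem_sdiff] at hz
      by_cases hzt : z = t
      · simp [hzt]
      · refine mem_insert_of_mem (mem_filter.2 ⟨mem_erase.2 ⟨hzt, hz.1⟩, fun h => ?_, fun h => ?_⟩)
        · have hzA : z = A := Subtype.ext h
          rcases hAt with h' | h'
          · exact hz.2 (hzA ▸ h')
          · exact hzt (hzA.trans h')
        · exact hz.2 ((Subtype.ext h : z = B) ▸ hBS)
    have hle : #(S ∪ T) ≤ 2 * n := by
      have h1 := card_le_card hsub
      have h2 := card_insert_le t
        (Finset.filter (fun z : Set.Icc a b => (z : ℝ) ≠ a ∧ (z : ℝ) ≠ b) (T.erase t))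
      have h3 : #(S ∪ T) = #S + #(T \ S) := by rw [← card_union_of_disjoint disjoint_sdiff,
        union_sdiff_self_eq_union]
      omega
    have := hg.weights_eq hab hle hsum hsum' t (mem_union_right _ htT)
    rw [if_neg htS, if_pos htT] at this
    exact (hw' t htT).ne this
  refine ⟨S, w, by omega, ?_, hBS, hw, hsum⟩
  -- Without `a`, the `n` nodes other than `b` would all be interior, one too many.
  by_contra hAS
  have : (Finset.filter (fun z : Set.Icc a b => (z : ℝ) ≠ a ∧ (z : ℝ) ≠ b) (S.erase B)) = S.erase B := by
    refine filter_true_of_mem fun z hz => ⟨fun h => ?_, fun h => ?_⟩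
    · exact hAS ((Subtype.ext h : z = A) ▸ mem_of_mem_erase hz)
    · exact ne_of_mem_erase hz (Subtype.ext h)
  rw [this, card_erase_of_mem hBS] at hSi
  omega

end Quadrature

/-! ### Derivatives and integrals on the interval. -/

section Calculus

variable {a b : ℝ}

lemma extendZero_coe (u : Set.Icc a b → ℝ) (t : Set.Icc a b) : extendZero u t = u t :=
  Subtype.val_injective.extend_apply u 0 t

lemma extendZero_of_notMem (u : Set.Icc a b → ℝ) {t : ℝ} (ht : t ∉ Set.Icc a b) :
    extendZero u t = 0 :=
  Function.extend_apply' _ _ _ fun ⟨s, hs⟩ => ht (hs ▸ s.2)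

lemma extendZero_mul (u v : Set.Icc a b → ℝ) :
    extendZero (u * v) = extendZero u * extendZero v := by
  ext t
  by_cases ht : t ∈ Set.Icc a b
  · lift t to Set.Icc a b using ht
    simp [extendZero_coe]
  · simp [extendZero_of_notMem _ ht]

lemma extendZero_add (u v : Set.Icc a b → ℝ) :
    extendZero (u + v) = extendZero u + extendZero v := by
  ext t
  by_cases ht : t ∈ Set.Icc a b
  · lift t to Set.Icc a b using ht
    simp [extendZero_coe]
  · simp [extendZero_of_notMem _ ht]

lemma extendZero_smul (r : ℝ) (u : Set.Icc a b → ℝ) :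
    extendZero (r • u) = r • extendZero u := by
  ext t
  by_cases ht : t ∈ Set.Icc a b
  · lift t to Set.Icc a b using ht
    simp [extendZero_coe]
  · simp [extendZero_of_notMem _ ht]

lemma IsC1.mul {u v : Set.Icc a b → ℝ} (hu : IsC1 u) (hv : IsC1 v) : IsC1 (u * v) := by
  unfold IsC1
  rw [extendZero_mul]
  exact ContDiffOn.mul hu hv

lemma IsC1.differentiableOn {u : Set.Icc a b → ℝ} (hu : IsC1 u) :
    DifferentiableOn ℝ (extendZero u) (Set.Icc a b) :=
  ContDiffOn.differentiableOn hu one_ne_zero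

lemma ddx_add {u v : Set.Icc a b → ℝ} (hu : IsC1 u) (hv : IsC1 v) :
    ddx (u + v) = ddx u + ddx v := by
  ext t
  simp only [ddx, extendZero_add, Pi.add_apply]
  exact derivWithin_add (hu.differentiableOn t t.2) (hv.differentiableOn t t.2)

lemma ddx_smul (r : ℝ) {u : Set.Icc a b → ℝ} (hu : IsC1 u) : ddx (r • u) = r • ddx u := by
  ext t
  simp only [ddx, extendZero_smul, Pi.smul_apply]
  exact derivWithin_const_smul r (hu.differentiableOn t t.2)

lemma ddx_mul {u v : Set.Icc a b → ℝ} (hu : IsC1 u) (hv : IsC1 v) (t : Set.Icc a b) :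
    ddx (u * v) t = ddx u t * v t + u t * ddx v t := by
  simp only [ddx, extendZero_mul]
  rw [derivWithin_mul (hu.differentiableOn t t.2) (hv.differentiableOn t t.2), extendZero_coe,
    extendZero_coe]

lemma integral_ddx (hab : a < b) {u : Set.Icc a b → ℝ} (hu : IsC1 u) :
    integral (ddx u) = u ⟨b, Set.right_mem_Icc.2 hab.le⟩ - u ⟨a, Set.left_mem_Icc.2 hab.le⟩ := by
  have h1 : integral (ddx u) = ∫ t in a..b, derivWithin (extendZero u) (Set.Icc a b) t := by
    refine intervalIntegral.integral_congr fun t ht => ?_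
    rw [Set.uIcc_of_le hab.le] at ht
    exact extendZero_coe (ddx u) ⟨t, ht⟩
  have hc : ContinuousOn (derivWithin (extendZero u) (Set.Icc a b)) (Set.Icc a b) :=
    ContDiffOn.continuousOn_derivWithin hu (uniqueDiffOn_Icc hab) le_rfl
  rw [h1, intervalIntegral.integral_eq_sub_of_hasDerivAt_of_le hab.le
    hu.differentiableOn.continuousOn (fun t ht => ?_) (hc.intervalIntegrable_of_Icc hab.le)]
  · rw [← extendZero_coe u ⟨b, Set.right_mem_Icc.2 hab.le⟩,
      ← extendZero_coe u ⟨a, Set.left_mem_Icc.2 hab.le⟩]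
  · exact ((hu.differentiableOn t (Set.Ioo_subset_Icc_self ht)).hasDerivWithinAt).hasDerivAt
      (Icc_mem_nhds ht.1 ht.2)

/-- The extension by zero may jump at the endpoints; extension through `Set.projIcc` keeps
continuity, hence integrability. -/
lemma integral_eq (hab : a ≤ b) (u : Set.Icc a b → ℝ) :
    integral u = ∫ t in a..b, u (Set.projIcc a b hab t) := by
  refine intervalIntegral.integral_congr fun t ht => ?_
  rw [Set.uIcc_of_le hab] at ht
  rw [Set.projIcc_of_mem hab ht]
  exact extendZero_coe u ⟨t, ht⟩

lemma integral_comb {N : ℕ} (hab : a ≤ b) {g : Fin N → Set.Icc a b → ℝ}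
    (hg : ∀ j, Continuous (g j)) (c : Fin N → ℝ) :
    integral (comb g c) = c ⬝ᵥ fun j => integral (g j) := by
  have hint : ∀ j, IntervalIntegrable (fun t => g j (Set.projIcc a b hab t))
      MeasureTheory.volume a b := fun j =>
    ((hg j).comp continuous_projIcc).intervalIntegrable a b
  simp only [integral_eq hab, comb, dotProduct]
  rw [intervalIntegral.integral_finsetSum fun j _ => (hint j).const_mul (c j)]
  simp only [intervalIntegral.integral_const_mul]

lemma IsTchebyshevSystem.integral_comb_pos {n : ℕ} (hab : a < b)
    {g : Fin (2 * n) → Set.Icc a b → ℝ} (hg : IsTchebyshevSystem g) {c : Fin (2 * n) → ℝ}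
    (hc : c ≠ 0) (hpos : ∀ x, 0 ≤ comb g c x) : 0 < c ⬝ᵥ fun j => integral (g j) := by
  have : Infinite (Set.Icc a b) := Set.Icc.infinite hab
  rw [← integral_comb hab.le hg.1, integral_eq hab.le]
  obtain ⟨x, hx⟩ : ∃ x, comb g c x ≠ 0 := by
    by_contra! hcon
    obtain ⟨Z, hZ⟩ := Infinite.exists_subset_card_eq (Set.Icc a b) (n + 1)
    have := hg.card_zeros_le hc hpos (Z := Z) fun x _ => hcon x
    omega
  refine intervalIntegral.integral_pos hab
    ((hg.continuous_comb c).comp continuous_projIcc).continuousOn (fun t _ => hpos _)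
    ⟨x, x.2, ?_⟩
  simpa using lt_of_le_of_ne (hpos x) hx.symm

lemma isExact_span_iff {N m : ℕ} (hab : a ≤ b) {g : Fin N → Set.Icc a b → ℝ}
    (hg : ∀ j, Continuous (g j)) {x : Fin m → Set.Icc a b} {w : Fin m → ℝ} :
    IsExact (Submodule.span ℝ (Set.range g)) x w ↔
      ∀ j, ∑ k, w k * g j (x k) = integral (g j) := by
  refine ⟨fun h j => (h _ (Submodule.subset_span ⟨j, rfl⟩)).symm, fun h u hu => ?_⟩
  obtain ⟨c, rfl⟩ := (Submodule.mem_span_range_iff_exists_fun ℝ).1 hu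
  have hcomb : ∑ j, c j • g j = comb g c := by
    ext t
    simp [comb, dotProduct, Finset.sum_apply]
  rw [hcomb, integral_comb hab hg]
  simp only [comb, dotProduct, mul_sum, ← h]
  rw [sum_comm]
  exact sum_congr rfl fun k _ => sum_congr rfl fun j _ => by ring

end Calculus

/-! ### Uniqueness, minimality and the index of the rule. -/

section Lobatto

variable {a b : ℝ} {n : ℕ} {g : Fin (2 * n) → Set.Icc a b → ℝ} {c : Fin (2 * n) → ℝ}

/-- A moment vector that is strictly positive on nonnegative combinations has a Lobatto
representation with positive weights; it is minimal and unique among representations with closed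
nodes. -/
lemma IsTchebyshevSystem.exists_unique_lobatto (hab : a < b) (hn : 1 ≤ n)
    (hg : IsTchebyshevSystem g)
    (hc : ∀ u : Fin (2 * n) → ℝ, u ≠ 0 → (∀ x, 0 ≤ comb g u x) → 0 < u ⬝ᵥ c) :
    ∃ (x : Fin (n + 1) → Set.Icc a b) (w : Fin (n + 1) → ℝ),
      StrictMono x ∧ ClosedNodes x ∧ (∀ k, 0 < w k) ∧ (∀ j, ∑ k, w k * g j (x k) = c j) ∧
      (∀ (m : ℕ) (x' : Fin m → Set.Icc a b) (w' : Fin m → ℝ), StrictMono x' → ClosedNodes x' →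
        (∀ j, ∑ k, w' k * g j (x' k) = c j) → n + 1 ≤ m) ∧
      ∀ (x' : Fin (n + 1) → Set.Icc a b) (w' : Fin (n + 1) → ℝ), StrictMono x' →
        ClosedNodes x' → (∀ j, ∑ k, w' k * g j (x' k) = c j) → x' = x ∧ w' = w := by
  obtain ⟨S, W, hS, hA, hB, hW, hsum⟩ := hg.exists_lobatto hab hn hc
  have key : ∀ (m : ℕ) (x' : Fin m → Set.Icc a b) (w' : Fin m → ℝ), m ≤ n + 1 → StrictMono x' →
      ClosedNodes x' → (∀ j, ∑ k, w' k * g j (x' k) = c j) →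
        S ⊆ univ.image x' ∧ ∀ k, x' k ∈ S → w' k = W (x' k) := by
    intro m x' w' hm hx' hcl hsum'
    have hcard : #(univ.image x') = m := by simp [card_image_of_injective _ hx'.injective]
    have hext : ∀ k, Function.extend x' w' 0 (x' k) = w' k := hx'.injective.extend_apply w' 0
    -- Both node sets contain `a` and `b`, which saves two in the count. Only the weights on `S`
    -- need be positive for what follows.
    have hle : #(S ∪ univ.image x') ≤ 2 * n := by
      obtain ⟨⟨i, hi⟩, ⟨j, hj⟩⟩ := hcl
      have h2 : 1 < #(S ∩ univ.image x') := by
        refine one_lt_card.2 ⟨x' i, mem_inter.2 ⟨?_, mem_image_of_mem _ (mem_univ _)⟩, x' j,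
          mem_inter.2 ⟨?_, mem_image_of_mem _ (mem_univ _)⟩, fun h => ?_⟩
        · exact (Subtype.ext hi : x' i = ⟨a, Set.left_mem_Icc.2 hab.le⟩) ▸ hA
        · exact (Subtype.ext hj : x' j = ⟨b, Set.right_mem_Icc.2 hab.le⟩) ▸ hB
        · exact hab.ne (hi.symm.trans ((congrArg Subtype.val h).trans hj))
      have := card_union_add_card_inter S (univ.image x')
      omega
    have heq := hg.weights_eq hab hle (w' := Function.extend x' w' 0) hsum fun j => by
      rw [sum_image hx'.injective.injOn]
      simpa only [hext] using hsum' j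
    refine ⟨fun z hz => ?_, fun k hk => ?_⟩
    · by_contra hzT
      have := heq z (mem_union_left _ hz)
      rw [if_pos hz, if_neg hzT] at this
      exact (hW z hz).ne' this
    · have := heq (x' k) (mem_union_left _ hk)
      rw [if_pos hk, if_pos (mem_image_of_mem _ (mem_univ _)), hext] at this
      exact this.symm
  let e := S.orderEmbOfFin hS
  have himg : univ.image e = S := image_orderEmbOfFin_univ S hS
  have hrange : ∀ z ∈ S, ∃ k, e k = z := fun z hz => by
    rw [← himg] at hz
    simpa using hz
  have hmem : ∀ k, e k ∈ S := S.orderEmbOfFin_mem hS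
  refine ⟨e, fun k => W (e k), e.strictMono, ⟨?_, ?_⟩, fun k => hW _ (hmem k), fun j => ?_, ?_, ?_⟩
  · obtain ⟨k, hk⟩ := hrange _ hA
    exact ⟨k, by rw [hk]⟩
  · obtain ⟨k, hk⟩ := hrange _ hB
    exact ⟨k, by rw [hk]⟩
  · rw [← hsum, ← sum_image (f := fun z => W z * g j z) (g := e) e.injective.injOn, himg]
  · intro m x' w' hx' hcl hsum'
    by_contra! hlt
    have h1 := card_le_card (key m x' w' hlt.le hx' hcl hsum').1
    rw [card_image_of_injective _ hx'.injective] at h1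
    simp at h1
    omega
  · intro x' w' hx' hcl hsum'
    obtain ⟨h1, h2⟩ := key _ x' w' le_rfl hx' hcl hsum'
    have h3 : S = univ.image x' := eq_of_subset_of_card_le h1 (by
      rw [card_image_of_injective _ hx'.injective, hS]; simp)
    have hxe : x' = e := by
      refine (StrictMono.range_inj hx' e.strictMono).1 ?_
      have := congrArg (fun T : Finset (Set.Icc a b) => (T : Set (Set.Icc a b))) (h3.symm.trans himg.symm)
      simpa using this
    refine ⟨hxe, funext fun k => ?_⟩
    rw [h2 k (by rw [hxe]; exact hmem k), hxe]

lemma nodeIndex_of_right_mem (hab : a < b) {m : ℕ} {x : Fin m → Set.Icc a b} (hx : StrictMono x)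
    (hb : ∃ k, (x k : ℝ) = b) :
    ((∃ k, (x k : ℝ) = a) ∧ nodeIndex x = m - 1) ∨
      ((¬ ∃ k, (x k : ℝ) = a) ∧ nodeIndex x = m - 1 / 2) := by
  obtain ⟨j, hj⟩ := hb
  have hval : ∀ {i k}, (x i : ℝ) = x k → i = k := fun h => hx.injective (Subtype.ext h)
  have hsum : nodeIndex x = m - ∑ k, ((if (x k : ℝ) = a then (1 / 2 : ℝ) else 0) +
      if k = j then (1 / 2 : ℝ) else 0) := by
    have : (m : ℝ) = ∑ _k : Fin m, (1 : ℝ) := by simp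
    rw [this, ← sum_sub_distrib]
    refine sum_congr rfl fun k _ => ?_
    have hkb : (x k : ℝ) = b ↔ k = j := ⟨fun h => hval (h.trans hj.symm), fun h => h ▸ hj⟩
    have hnot : (x k : ℝ) = a → k ≠ j := fun h hkj => hab.ne (by rw [← h, hkj, hj])
    simp only [hkb]
    by_cases h1 : (x k : ℝ) = a
    · simp only [h1, hnot h1, true_or, if_true, if_false]
      norm_num
    · by_cases h2 : k = j
      · simp only [h2, or_true, if_true]
        have : (x j : ℝ) ≠ a := h2 ▸ h1
        simp only [this, if_false]
        norm_num
      · simp [h1, h2]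
  rw [sum_add_distrib, sum_ite_eq' univ j, if_pos (mem_univ _)] at hsum
  by_cases ha : ∃ k, (x k : ℝ) = a
  · refine Or.inl ⟨ha, ?_⟩
    obtain ⟨i, hi⟩ := ha
    have hki : ∀ k, (x k : ℝ) = a ↔ k = i :=
      fun k => ⟨fun h => hval (h.trans hi.symm), fun h => h ▸ hi⟩
    simp only [hki, sum_ite_eq', mem_univ, if_true] at hsum
    rw [hsum]; ring
  · refine Or.inr ⟨ha, ?_⟩
    rw [not_exists] at ha
    simp only [ha, if_false, sum_const_zero] at hsum
    rw [hsum]; ring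

/-- Since the index is the integer `n`, the half contributed by `b` must be matched by one from `a`.
-/
lemma IsUpperPrincipalRepresentation.closedNodes (hab : a < b) {m : ℕ} {x : Fin m → Set.Icc a b}
    {w : Fin m → ℝ} (h : IsUpperPrincipalRepresentation g c x w) :
    ClosedNodes x ∧ m = n + 1 := by
  have hidx := h.index_eq
  rcases nodeIndex_of_right_mem hab h.strictMono h.right_mem with ⟨ha, hi⟩ | ⟨-, hi⟩
  · refine ⟨⟨ha, h.right_mem⟩, ?_⟩
    rw [hi] at hidx
    push_cast at hidx
    have : (m : ℝ) = n + 1 := by linarith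
    exact_mod_cast this
  · rw [hi] at hidx
    push_cast at hidx
    have : (2 * m : ℝ) = 2 * n + 1 := by linarith
    have : 2 * m = 2 * n + 1 := by exact_mod_cast this
    omega

lemma isUpperPrincipalRepresentation_of_closedNodes (hab : a < b) {x : Fin (n + 1) → Set.Icc a b}
    {w : Fin (n + 1) → ℝ} (hx : StrictMono x) (hcl : ClosedNodes x) (hw : ∀ k, 0 < w k)
    (hsum : ∀ j, ∑ k, w k * g j (x k) = c j) : IsUpperPrincipalRepresentation g c x w := by
  refine ⟨hx, hw, hsum, ?_, hcl.2⟩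
  rcases nodeIndex_of_right_mem hab hx hcl.2 with ⟨-, hi⟩ | ⟨ha, -⟩
  · rw [hi]
    push_cast
    ring
  · exact absurd hcl.1 ha

end Lobatto

open Matrix

/-! ### Skew-symmetric extension. -/

section Skew

/-- Prescribed values on the range of an injective map that are compatible with skew-symmetry
extend to a skew-symmetric matrix. -/
lemma exists_skew_matrix {V : Type*} [AddCommGroup V] [Module ℝ V] {m : ℕ}
    (R Φ : V →ₗ[ℝ] Fin m → ℝ) (hR : Function.Injective R)
    (h : ∀ u v, R u ⬝ᵥ Φ v + Φ u ⬝ᵥ R v = 0) :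
    ∃ A : Matrix (Fin m) (Fin m) ℝ, A + Aᵀ = 0 ∧ ∀ v, A *ᵥ R v = Φ v := by
  obtain ⟨L, hL⟩ := LinearMap.exists_leftInverse_of_injective R (LinearMap.ker_eq_bot.2 hR)
  have hLR : ∀ v, L (R v) = v := fun v => congrArg (fun f => f v) hL
  let S : Matrix (Fin m) (Fin m) ℝ := LinearMap.toMatrix' (Φ ∘ₗ L)
  let E : Matrix (Fin m) (Fin m) ℝ := LinearMap.toMatrix' (R ∘ₗ L)
  have hS : ∀ y, S *ᵥ y = Φ (L y) := fun y => by
    rw [← Matrix.toLin'_apply, Matrix.toLin'_toMatrix']; rfl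
  have hP : ∀ y, E *ᵥ y = R (L y) := fun y => by
    rw [← Matrix.toLin'_apply, Matrix.toLin'_toMatrix']; rfl
  have hskew : Sᵀ * E + Eᵀ * S = 0 := by
    refine Matrix.ext_iff_mulVec.2 fun y => ?_
    refine dotProduct_eq _ _ fun z => ?_
    rw [Matrix.zero_mulVec, zero_dotProduct, Matrix.add_mulVec, add_dotProduct,
      ← Matrix.mulVec_mulVec, ← Matrix.mulVec_mulVec, Matrix.mulVec_transpose,
      Matrix.mulVec_transpose, ← Matrix.dotProduct_mulVec, ← Matrix.dotProduct_mulVec, hS, hP, hS,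
      hP, h]
  -- `E` projects onto the range of `R`, so `-Sᵀ + Sᵀ * E` vanishes there and leaves `S`; the
  -- symmetric part is killed by `hskew`.
  refine ⟨S - Sᵀ + Sᵀ * E, ?_, fun v => ?_⟩
  · rw [← hskew]
    simp only [Matrix.transpose_add, Matrix.transpose_sub, Matrix.transpose_mul,
      Matrix.transpose_transpose]
    abel
  · rw [Matrix.add_mulVec, Matrix.sub_mulVec, ← Matrix.mulVec_mulVec, hP, hS, hLR]
    abel

end Skew

/-! ### Operators and positive closed quadrature rules. -/

section Operators

variable {a b : ℝ} {F : Submodule ℝ (Set.Icc a b → ℝ)} {m n : ℕ}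

/-- Ordered nodes containing `a` and `b` have them in first and last position, where the boundary
matrix has its entries. -/
lemma boundaryMatrix_dotProduct (hab : a < b) {x : Fin m → Set.Icc a b} (hx : StrictMono x)
    (hcl : ClosedNodes x) (f h : Set.Icc a b → ℝ) :
    (fun i => f (x i)) ⬝ᵥ (boundaryMatrix m *ᵥ fun i => h (x i)) =
      (f * h) ⟨b, Set.right_mem_Icc.2 hab.le⟩ - (f * h) ⟨a, Set.left_mem_Icc.2 hab.le⟩ := by
  obtain ⟨⟨i, hi⟩, ⟨j, hj⟩⟩ := hcl
  have hi0 : ∀ k : Fin m, (k : ℕ) = 0 ↔ k = i := by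
    have : (i : ℕ) = 0 := by
      by_contra hne
      have := Subtype.coe_lt_coe.2 (hx (a := ⟨0, i.pos⟩) (b := i)
        (by rw [Fin.lt_def]; exact Nat.pos_of_ne_zero hne))
      rw [hi] at this
      exact not_le.2 this (x _).2.1
    intro k
    rw [Fin.ext_iff, this]
  have hj0 : ∀ k : Fin m, (k : ℕ) + 1 = m ↔ k = j := by
    have : (j : ℕ) + 1 = m := by
      by_contra hne
      have := Subtype.coe_lt_coe.2 (hx (a := j) (b := ⟨m - 1, by have := j.pos; omega⟩)
        (by rw [Fin.lt_def]; have := j.2; simp only; omega))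
      rw [hj] at this
      exact not_le.2 this (x _).2.2
    intro k
    rw [Fin.ext_iff]
    omega
  simp only [boundaryMatrix, Matrix.mulVec_diagonal, dotProduct, hi0, hj0]
  rw [← show x i = ⟨a, Set.left_mem_Icc.2 hab.le⟩ from Subtype.ext hi,
    ← show x j = ⟨b, Set.right_mem_Icc.2 hab.le⟩ from Subtype.ext hj]
  simp only [sub_mul, mul_sub, sum_sub_distrib, ite_mul, one_mul, zero_mul, mul_ite, mul_zero,
    sum_ite_eq', mem_univ, if_true, Pi.mul_apply]

lemma isExact_productDeriv {x : Fin m → Set.Icc a b} {w : Fin m → ℝ} {N : ℕ} (hab : a ≤ b)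
    {g : Fin N → Set.Icc a b → ℝ} (hg : ∀ j, Continuous (g j))
    (hspan : productDeriv F = Submodule.span ℝ (Set.range g))
    (h : ∀ u ∈ F, ∀ v ∈ F, integral (ddx (u * v)) = ∑ k, w k * ddx (u * v) (x k)) :
    IsExact (productDeriv F) x w := by
  -- Continuity makes the integral additive on the span.
  have hcont : ∀ y ∈ productDeriv F, Continuous y := by
    intro y hy
    rw [hspan] at hy
    induction hy using Submodule.span_induction with
    | mem y hy => obtain ⟨j, rfl⟩ := hy; exact hg j
    | zero => exact continuous_const
    | add y z _ _ hy hz => exact hy.add hz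
    | smul r y _ hy => exact hy.const_smul r
  have hint : ∀ y ∈ productDeriv F, IntervalIntegrable (fun t => y (Set.projIcc a b hab t))
      MeasureTheory.volume a b := fun y hy =>
    ((hcont y hy).comp continuous_projIcc).intervalIntegrable a b
  intro y hy
  induction hy using Submodule.span_induction with
  | mem y hy => obtain ⟨u, hu, v, hv, rfl⟩ := hy; exact h u hu v hv
  | zero => simp [integral_eq hab]
  | add y z hy hz ihy ihz =>
    rw [integral_eq hab] at ihy ihz ⊢
    simp only [Pi.add_apply]
    rw [intervalIntegral.integral_add (hint y hy) (hint z hz), ihy, ihz, ← sum_add_distrib]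
    simp only [mul_add]
  | smul r y hy ih =>
    rw [integral_eq hab] at ih ⊢
    simp only [Pi.smul_apply, smul_eq_mul]
    rw [intervalIntegral.integral_const_mul, ih, mul_sum]
    exact sum_congr rfl fun k _ => by ring

lemma Operator.mulVec_Q (T : Operator F m) {f : Set.Icc a b → ℝ} (hf : f ∈ F) :
    T.Q *ᵥ (fun i => f (T.nodes i)) = T.P *ᵥ fun i => ddx f (T.nodes i) := by
  rw [← T.exact_on f hf, Matrix.mulVec_mulVec, ← Matrix.mul_assoc,
    Matrix.mul_nonsing_inv _ ((Matrix.isUnit_iff_isUnit_det _).1 T.posDef.isUnit), Matrix.one_mul]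

/-- The norm matrix of a closed diagonal-norm operator is an exact quadrature rule. -/
lemma Operator.IsClosedDiagonal.isExact (hab : a < b) (hF : ∀ f ∈ F, IsC1 f) {N : ℕ}
    {g : Fin N → Set.Icc a b → ℝ} (hg : ∀ j, Continuous (g j))
    (hspan : productDeriv F = Submodule.span ℝ (Set.range g)) {T : Operator F m}
    (hT : T.IsClosedDiagonal) : IsExact (productDeriv F) T.nodes T.P.diag := by
  refine isExact_productDeriv hab.le hg hspan fun u hu v hv => ?_
  have hd : T.P = Matrix.diagonal T.P.diag := hT.2.diagonal_diag.symm
  rw [integral_ddx hab ((hF u hu).mul (hF v hv)),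
    ← boundaryMatrix_dotProduct hab T.strictMono hT.1, ← T.sbp, Matrix.add_mulVec,
    dotProduct_add, T.mulVec_Q hv, Matrix.mulVec_transpose, dotProduct_comm _ (_ ᵥ* _),
    ← Matrix.dotProduct_mulVec, T.mulVec_Q hu, hd]
  simp only [Matrix.mulVec_diagonal, dotProduct, ← sum_add_distrib]
  refine sum_congr rfl fun k _ => ?_
  rw [ddx_mul (hF u hu) (hF v hv)]
  simp only [Matrix.diag_diagonal]
  ring

/-- A positive closed quadrature rule that is exact on `(𝓕𝓕)'` and whose nodes are unisolvent
for `𝓕` is the norm matrix of an operator. -/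
lemma exists_operator (hab : a < b) (hF : ∀ f ∈ F, IsC1 f) {x : Fin m → Set.Icc a b}
    {w : Fin m → ℝ} (hx : StrictMono x) (hcl : ClosedNodes x) (hw : ∀ k, 0 < w k)
    (hex : IsExact (productDeriv F) x w) (hinj : ∀ f ∈ F, (∀ k, f (x k) = 0) → f = 0) :
    ∃ T : Operator F m, T.nodes = x ∧ T.P = Matrix.diagonal w := by
  let R : F →ₗ[ℝ] Fin m → ℝ :=
    { toFun := fun f i => f.1 (x i)
      map_add' := fun _ _ => rfl
      map_smul' := fun _ _ => rfl }
  let D : F →ₗ[ℝ] Fin m → ℝ :=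
    { toFun := fun f i => ddx f.1 (x i)
      map_add' := fun f h => by
        ext i
        simp [ddx_add (hF f f.2) (hF h h.2)]
      map_smul' := fun r f => by
        ext i
        simp [ddx_smul r (hF f f.2)] }
  -- With `Q = B/2 + A`, the requirement `Q f = P f'` on nodal values forces `A f = P f' - B f / 2`.
  let Φ : F →ₗ[ℝ] Fin m → ℝ :=
    Matrix.toLin' (Matrix.diagonal w) ∘ₗ D - (1 / 2 : ℝ) • Matrix.toLin' (boundaryMatrix m) ∘ₗ R
  have hΦ : ∀ f, Φ f = Matrix.diagonal w *ᵥ D f - (1 / 2 : ℝ) • (boundaryMatrix m *ᵥ R f) :=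
    fun f => rfl
  have hR : Function.Injective R := by
    refine (injective_iff_map_eq_zero R).2 fun f hf => Subtype.ext ?_
    exact hinj f f.2 fun k => congrFun hf k
  obtain ⟨A, hA, hAR⟩ := exists_skew_matrix R Φ hR fun u v => by
    have h1 : R u ⬝ᵥ boundaryMatrix m *ᵥ R v = _ :=
      boundaryMatrix_dotProduct hab hx hcl u.1 v.1
    have h2 : R v ⬝ᵥ boundaryMatrix m *ᵥ R u = _ :=
      boundaryMatrix_dotProduct hab hx hcl v.1 u.1
    have h3 := hex _ (Submodule.subset_span ⟨u.1, u.2, v.1, v.2, rfl⟩)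
    rw [integral_ddx hab ((hF u u.2).mul (hF v v.2))] at h3
    rw [mul_comm v.1 u.1] at h2
    rw [hΦ, hΦ, dotProduct_sub, sub_dotProduct, dotProduct_smul, smul_dotProduct,
      dotProduct_comm (boundaryMatrix m *ᵥ R u), h1, h2, h3]
    simp only [smul_eq_mul]
    have h4 : R u ⬝ᵥ Matrix.diagonal w *ᵥ D v + (Matrix.diagonal w *ᵥ D u) ⬝ᵥ R v =
        ∑ k, w k * ddx (u.1 * v.1) (x k) := by
      simp only [Matrix.mulVec_diagonal, dotProduct, ← sum_add_distrib]
      refine sum_congr rfl fun k _ => ?_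
      rw [ddx_mul (hF u u.2) (hF v v.2)]
      simp only [R, D, LinearMap.coe_mk, AddHom.coe_mk]
      ring
    linarith
  have hPd : (Matrix.diagonal w).PosDef := Matrix.PosDef.diagonal hw
  refine ⟨⟨x, Matrix.diagonal w, (1 / 2 : ℝ) • boundaryMatrix m + A, hx, fun f hf => ?_, hPd, ?_⟩,
    rfl, rfl⟩
  · have h1 : ((1 / 2 : ℝ) • boundaryMatrix m + A) *ᵥ R ⟨f, hf⟩ =
        Matrix.diagonal w *ᵥ D ⟨f, hf⟩ := by
      rw [Matrix.add_mulVec, hAR, hΦ, Matrix.smul_mulVec]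
      abel
    have h2 : (Matrix.diagonal w)⁻¹ *ᵥ (((1 / 2 : ℝ) • boundaryMatrix m + A) *ᵥ R ⟨f, hf⟩) =
        D ⟨f, hf⟩ := by
      rw [h1, Matrix.mulVec_mulVec, Matrix.nonsing_inv_mul _
        ((Matrix.isUnit_iff_isUnit_det _).1 hPd.isUnit), Matrix.one_mulVec]
    rw [Matrix.mulVec_mulVec] at h2
    exact h2
  · have hB : (boundaryMatrix m)ᵀ = boundaryMatrix m := Matrix.diagonal_transpose _
    rw [Matrix.transpose_add, Matrix.transpose_smul, hB]
    calc _ = (1 / 2 : ℝ) • boundaryMatrix m + (1 / 2 : ℝ) • boundaryMatrix m + (A + Aᵀ) := by abel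
      _ = boundaryMatrix m := by rw [hA, add_zero, ← add_smul]; norm_num

/-- If `(𝓕𝓕)'` is spanned by a Tchebyshev system of `2 n` functions, then no nonzero element of
`𝓕` vanishes at `n + 1` points. -/
lemma eq_zero_of_vanish (hab : a < b) (hF : ∀ f ∈ F, IsC1 f)
    {g : Fin (2 * n) → Set.Icc a b → ℝ} (hg : IsTchebyshevSystem g)
    (hspan : productDeriv F = Submodule.span ℝ (Set.range g)) {x : Fin (n + 1) → Set.Icc a b}
    (hx : StrictMono x) {f : Set.Icc a b → ℝ} (hf : f ∈ F) (h0 : ∀ k, f (x k) = 0) :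
    f = 0 := by
  have hfC := hF f hf
  have hrolle : ∀ i : Fin n, ∃ p, x i.castSucc < p ∧ p < x i.succ ∧ ddx f p = 0 := by
    intro i
    have hsub : Set.Icc (x i.castSucc : ℝ) (x i.succ) ⊆ Set.Icc a b :=
      Set.Icc_subset_Icc (x _).2.1 (x _).2.2
    obtain ⟨t, ht, hd⟩ := exists_deriv_eq_zero (f := extendZero f)
      (Subtype.coe_lt_coe.2 (hx i.castSucc_lt_succ))
      (hfC.differentiableOn.continuousOn.mono hsub)
      (by rw [extendZero_coe, extendZero_coe, h0, h0])
    refine ⟨⟨t, hsub (Set.Ioo_subset_Icc_self ht)⟩, ht.1, ht.2, ?_⟩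
    exact (derivWithin_of_mem_nhds (Icc_mem_nhds ((x _).2.1.trans_lt ht.1)
      (ht.2.trans_le (x _).2.2))).trans hd
  choose p hp1 hp2 hp using hrolle
  have hmem : ddx (f * f) ∈ Submodule.span ℝ (Set.range g) := by
    rw [← hspan]
    exact Submodule.subset_span ⟨f, hf, f, hf, rfl⟩
  obtain ⟨c, hc⟩ := (Submodule.mem_span_range_iff_exists_fun ℝ).1 hmem
  have hcomb : comb g c = ddx (f * f) := by
    rw [← hc]
    ext t
    simp [comb, dotProduct, Finset.sum_apply]
  obtain ⟨y, hy, hyy⟩ := exists_interleave hp1 hp2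
  have hy0 : ∀ i : Fin (2 * n + 1), comb g c (y i) = 0 := by
    intro i
    rw [hcomb, ddx_mul hfC hfC]
    rcases hyy i with ⟨-, k, hk⟩ | ⟨-, k, hk⟩
    · rw [hk, h0]; ring
    · rw [hk, hp]; ring
  -- The first `2n` of the `2n + 1` zeros already suffice.
  have hc0 : c = 0 := hg.eq_zero_of_comb
    (hy.injective.comp (Fin.castSucc_injective (2 * n))) fun i => hy0 _
  have hdd : ddx (f * f) = 0 := by
    rw [← hcomb, hc0]
    ext t
    simp [comb]
  have hconst : ∀ s : Set.Icc a b, f s * f s = f ⟨a, Set.left_mem_Icc.2 hab.le⟩ * f ⟨a, Set.left_mem_Icc.2 hab.le⟩ := by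
    intro s
    have := constant_of_derivWithin_zero (hfC.mul hfC).differentiableOn
      (fun t ht => congrFun hdd ⟨t, Set.Ico_subset_Icc_self ht⟩) s s.2
    rwa [extendZero_coe, extendZero_coe (f * f) ⟨a, Set.left_mem_Icc.2 hab.le⟩] at this
  ext t
  have h1 := hconst t
  rw [← hconst (x 0), h0, mul_zero] at h1
  exact mul_self_eq_zero.1 h1

end Operators

end FSBP

/-! ### Assembly of the corollary. -/

theorem corollary3p6 {a b : ℝ} (hab : a < b) (n : ℕ) (hn : 1 ≤ n)
    (F : Submodule ℝ (Set.Icc a b → ℝ)) [FiniteDimensional ℝ F]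
    (hF : ∀ f ∈ F, FSBP.IsC1 f)
    (g : Fin (2 * n) → Set.Icc a b → ℝ)
    (hspan : FSBP.productDeriv F = Submodule.span ℝ (Set.range g))
    (hg : FSBP.IsTchebyshevSystem g) :
    -- a closed diagonal-norm operator exists
    (∃ (m : ℕ) (T : FSBP.Operator F m), T.IsClosedDiagonal) ∧
    -- the generalised Gauss–Lobatto rule
    ∃ (x : Fin (n + 1) → Set.Icc a b) (w : Fin (n + 1) → ℝ),
      FSBP.IsGaussLobatto (FSBP.productDeriv F) x w ∧
      (∀ k, 0 < w k) ∧
      (∀ (x' : Fin (n + 1) → Set.Icc a b) (w' : Fin (n + 1) → ℝ),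
        FSBP.IsGaussLobatto (FSBP.productDeriv F) x' w' → x' = x ∧ w' = w) ∧
      -- it is the unique upper principal representation of the moments of Lebesgue measure
      (∀ (m : ℕ) (x' : Fin m → Set.Icc a b) (w' : Fin m → ℝ),
        FSBP.IsUpperPrincipalRepresentation g (fun j => FSBP.integral (g j)) x' w' → m = n + 1) ∧
      (∀ (x' : Fin (n + 1) → Set.Icc a b) (w' : Fin (n + 1) → ℝ),
        FSBP.IsUpperPrincipalRepresentation g (fun j => FSBP.integral (g j)) x' w' ↔ x' = x ∧ w' = w) ∧
      -- optimal closed diagonal-norm operators exist in dimension `n + 1`, only there, and are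
      -- exactly the operators whose nodes and weights are those of the rule
      (∃ T : FSBP.Operator F (n + 1), T.IsOptimalClosedDiagonal) ∧
      (∀ (m : ℕ) (T : FSBP.Operator F m), T.IsOptimalClosedDiagonal → m = n + 1) ∧
      (∀ T : FSBP.Operator F (n + 1),
        T.IsOptimalClosedDiagonal ↔ T.nodes = x ∧ T.P = Matrix.diagonal w) := by
  obtain ⟨x, w, hx, hcl, hw, hsum, hmin, huniq⟩ := hg.exists_unique_lobatto hab hn
    (c := fun j => FSBP.integral (g j)) fun u hu hpos => hg.integral_comb_pos hab hu hpos
  have hexact : ∀ {m : ℕ} {x' : Fin m → Set.Icc a b} {w' : Fin m → ℝ},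
      FSBP.IsExact (FSBP.productDeriv F) x' w' ↔
        ∀ j, ∑ k, w' k * g j (x' k) = FSBP.integral (g j) := by
    intro m x' w'
    rw [hspan]
    exact FSBP.isExact_span_iff hab.le hg.1
  have hdim : ∀ (m : ℕ) (T : FSBP.Operator F m), T.IsClosedDiagonal → n + 1 ≤ m := fun m T hT =>
    hmin m T.nodes T.P.diag T.strictMono hT.1 (hexact.1 (hT.isExact hab hF hg.1 hspan))
  have hopt : ∀ T : FSBP.Operator F (n + 1),
      T.IsOptimalClosedDiagonal ↔ T.nodes = x ∧ T.P = Matrix.diagonal w := by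
    refine fun T => ⟨fun hT => ?_, fun ⟨h1, h2⟩ => ⟨⟨?_, ?_⟩, fun k hk ⟨S, hS⟩ => ?_⟩⟩
    · obtain ⟨h1, h2⟩ := huniq T.nodes T.P.diag T.strictMono hT.1.1
        (hexact.1 (hT.1.isExact hab hF hg.1 hspan))
      exact ⟨h1, by rw [← h2, hT.1.2.diagonal_diag]⟩
    · rwa [h1]
    · rw [h2]
      exact Matrix.isDiag_diagonal w
    · have := hdim k S hS
      omega
  obtain ⟨T, hT⟩ := FSBP.exists_operator hab hF hx hcl hw (hexact.2 hsum)
    fun f hf h0 => FSBP.eq_zero_of_vanish hab hF hg hspan hx hf h0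
  have hTopt := (hopt T).2 hT
  refine ⟨⟨n + 1, T, hTopt.1⟩, x, w, ⟨hx, hcl, hexact.2 hsum⟩, hw,
    fun x' w' h => huniq x' w' h.strictMono h.closed (hexact.1 h.exact_on),
    fun m x' w' h => (h.closedNodes hab).2, fun x' w' => ⟨fun h => ?_, ?_⟩, ⟨T, hTopt⟩,
    fun m S hS => ?_, hopt⟩
  · exact huniq x' w' h.strictMono (h.closedNodes hab).1 h.represents
  · rintro ⟨rfl, rfl⟩
    exact FSBP.isUpperPrincipalRepresentation_of_closedNodes hab hx hcl hw hsum
  · refine le_antisymm ?_ (hdim m S hS.1)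
    by_contra! hlt
    exact hS.2 (n + 1) hlt ⟨T, hTopt.1⟩
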